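/- Let $T(x)=\frac1x-\lfloor \frac1x\rfloor$ for $x\in(0,1]$ and $T(0)=0$ be the Gauss map, and let $\hat T_{slow}:[0,1]^2\to[0,1]^2$ be the map given for $0<x\le 1$ by $$\hat T_{slow}(x,y)=\begin{cases}\left(T(1-x),\frac{y}{1-x}\right), & 0\le y<1-x,\\[2pt] \left(T(x),\frac{1-y}{x}\right), & 1-x\le y\le 1,\end{cases}$$ and by $\hat T_{slow}(0,y)=(0,y)$ for $x=0$. Let $\lambda$ denote Lebesgue measure on $[0,1]^2$. Then: (1) there is no Borel probability measure $\nu$ on $[0,1]^2$ that is invariant under $\hat T_{slow}$, absolutely continuous with respect to $\lambda$, and has an (essentially) bounded Radon–Nikodym derivative $d\nu/d\lambda$; (2) there is a $\sigma$-finite Borel measure $\mu$ on $[0,1]^2$ that is invariant under $\hat T_{slow}$, mutually absolutely continuous with respect to $\lambda$, and satisfies $\mu([0,1]^2)=\infty$. -/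

import Mathlib

open MeasureTheory Set
open scoped NNReal ENNReal

noncomputable section

/-- The Gauss map `T(x) = 1/x - ⌊1/x⌋` (with `T(0) = 0`, as `1/0 = 0` in Lean). -/
def gaussMap (x : ℝ) : ℝ := 1 / x - (⌊1 / x⌋ : ℝ)

/-- The unit square `[0,1]²`. -/
def unitSq : Set (ℝ × ℝ) := Icc 0 1 ×ˢ Icc 0 1

/-- Lebesgue measure on the unit square, as a measure on the plane carried by the square. -/
def lebSq : Measure (ℝ × ℝ) := volume.restrict unitSq

/-- The slow map on the unit square. It is the identity on the segment `x = 0`; for `x > 0` it is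
`(T(1-x), y/(1-x))` below the line `y = 1 - x` and `(T(x), (1-y)/x)` on and above that line.
On `x = 1` this is `(1,y) ↦ (0,1-y)`. The values outside the unit square play no role. -/
def slowMap (p : ℝ × ℝ) : ℝ × ℝ :=
  if p.1 = 0 then p
  else if p.2 < 1 - p.1 then (gaussMap (1 - p.1), p.2 / (1 - p.1))
  else (gaussMap p.1, (1 - p.2) / p.1)

theorem gaussMap_mem (x : ℝ) : gaussMap x ∈ Icc (0 : ℝ) 1 :=
  ⟨Int.fract_nonneg (1 / x), (Int.fract_lt_one (1 / x)).le⟩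

theorem slowMap_one (y : ℝ) (hy : 0 ≤ y) : slowMap (1, y) = (0, 1 - y) := by
  have h : ¬ y < 0 := not_lt.mpr hy
  simp [slowMap, gaussMap, h]

/-- The slow map sends the unit square to itself. -/
theorem slowMap_mapsTo : MapsTo slowMap unitSq unitSq := by
  rintro ⟨x, y⟩ ⟨⟨hx0, hx1⟩, hy0, hy1⟩
  simp only at hx0 hx1 hy0 hy1
  unfold slowMap
  by_cases h0 : x = 0
  · simp only [h0, if_true]
    exact ⟨⟨le_rfl, zero_le_one⟩, hy0, hy1⟩
  · have hx : 0 < x := lt_of_le_of_ne hx0 (Ne.symm h0)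
    by_cases h : y < 1 - x
    · simp only [h0, h, if_true, if_false]
      have h1 : 0 < 1 - x := lt_of_le_of_lt hy0 h
      exact ⟨gaussMap_mem _, div_nonneg hy0 h1.le, (div_le_one h1).mpr h.le⟩
    · simp only [h0, h, if_false]
      exact ⟨gaussMap_mem _, div_nonneg (by linarith) hx.le,
        (div_le_one hx).mpr (by linarith)⟩

end

/-!
The slow map has an explicit invariant measure `μ = dx dy / x`. Its inverse branches are
`(u, v) ↦ (1 - 1 / (n + u), v / (n + u))` and `(u, v) ↦ (1 / (n + u), 1 - v / (n + u))` for `n ≥ 1`,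
each with Jacobian `1 / (n + u) ^ 3`. The transfer operator therefore sends `1 / x` to
`∑ ((n + u) / (n + u - 1) + (n + u)) / (n + u) ^ 3 = ∑ 1 / ((n + u - 1) (n + u)) = 1 / u`
(`tsum_branch_density`, `measurePreserving_slowMap`). This measure is infinite because `1 / x` is
not integrable at `0`.

If `ν` is invariant with density at most `C` with respect to Lebesgue measure, then its density
with respect to `μ` is at most `C * x`, so it is bounded and tends to `0` at `x = 0`. It is also
harmonic for the Markov operator that averages over preimages with the weights given by `μ`. Each
point has preimages arbitrarily close to `x = 0`, of positive weight, bounded below for points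
away from `x = 0`. So the maximum principle (`exists_lt_invMeasure_bound`) lowers every positive
upper bound of that density, and the least one is `0` (`eq_zero_of_le_lebSq`). No appeal to
ergodicity is needed.
-/

/-- The measure `dx dy / x` on the unit square. -/
noncomputable def invMeasure : Measure (ℝ × ℝ) := lebSq.withDensity fun p => ENNReal.ofReal p.1⁻¹

/-- The open unit square. Boundary points are discarded so that the inverse branches below have
pairwise disjoint images; the boundary is Lebesgue-null. -/
def openSq : Set (ℝ × ℝ) := Ioo 0 1 ×ˢ Ioo 0 1

/-- The inverse branches of `slowMap`, the index `n` standing for the partial quotient `n + 1`: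
`false` is the part below the line `y = 1 - x`, `true` the part above it. -/
noncomputable def invBranch : Bool → ℕ → ℝ × ℝ → ℝ × ℝ
  | false, n, p => (1 - (n + 1 + p.1)⁻¹, p.2 * (n + 1 + p.1)⁻¹)
  | true, n, p => ((n + 1 + p.1)⁻¹, 1 - p.2 * (n + 1 + p.1)⁻¹)

/-! ### The slow map and its inverse branches -/
theorem measurable_slowMap : Measurable slowMap := by
  have hg : Measurable gaussMap := by
    unfold gaussMap
    have h1 : Measurable fun x : ℝ => 1 / x := measurable_const.div measurable_id
    exact h1.sub (measurable_from_top.comp (Int.measurable_floor.comp h1))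
  unfold slowMap
  refine Measurable.ite (measurableSet_eq_fun measurable_fst measurable_const) measurable_id
    (Measurable.ite (measurableSet_lt measurable_snd (measurable_const.sub measurable_fst)) ?_ ?_)
  · exact (hg.comp (measurable_const.sub measurable_fst)).prodMk
      (measurable_snd.div (measurable_const.sub measurable_fst))
  · exact (hg.comp measurable_fst).prodMk
      ((measurable_const.sub measurable_snd).div measurable_fst)

theorem measurableSet_openSq : MeasurableSet openSq := measurableSet_Ioo.prod measurableSet_Ioo

theorem openSq_ae_eq_unitSq : openSq =ᵐ[volume] unitSq :=
  Measure.set_prod_ae_eq Ioo_ae_eq_Icc Ioo_ae_eq_Icc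

theorem invMeasure_eq :
    invMeasure = (volume.restrict openSq).withDensity fun p => ENNReal.ofReal p.1⁻¹ := by
  rw [invMeasure, lebSq, Measure.restrict_congr_set openSq_ae_eq_unitSq]

theorem gaussMap_inv_add (n : ℕ) {u : ℝ} (hu : u ∈ Ioo (0 : ℝ) 1) :
    gaussMap (n + 1 + u)⁻¹ = u := by
  have h : ⌊(n : ℝ) + 1 + u⌋ = n + 1 := by
    rw [Int.floor_eq_iff]
    push_cast
    exact ⟨by linarith [hu.1], by linarith [hu.2]⟩
  rw [gaussMap, one_div, inv_inv, h]
  push_cast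
  ring

theorem inv_add_mem (n : ℕ) {u : ℝ} (hu : u ∈ Ioo (0 : ℝ) 1) :
    ((n : ℝ) + 1 + u)⁻¹ ∈ Ioo (0 : ℝ) 1 := by
  have : (0 : ℝ) ≤ n := n.cast_nonneg
  exact ⟨inv_pos.2 (by linarith [hu.1]), inv_lt_one_of_one_lt₀ (by linarith [hu.1])⟩

theorem slowMap_of_lt {x y : ℝ} (hx : x ≠ 0) (h : y < 1 - x) :
    slowMap (x, y) = (gaussMap (1 - x), y / (1 - x)) := by
  simp [slowMap, hx, h]

theorem slowMap_of_le {x y : ℝ} (hx : x ≠ 0) (h : 1 - x ≤ y) :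
    slowMap (x, y) = (gaussMap x, (1 - y) / x) := by
  simp [slowMap, hx, not_lt.2 h]

theorem slowMap_invBranch (b : Bool) (n : ℕ) {p : ℝ × ℝ} (hp : p ∈ openSq) :
    slowMap (invBranch b n p) = p := by
  obtain ⟨u, v⟩ := p
  obtain ⟨hu, hv⟩ := hp
  simp only at hu hv
  have hw := inv_add_mem n hu
  have hg := gaussMap_inv_add n hu
  cases b <;> simp only [invBranch]
  · rw [slowMap_of_lt (by linarith [hw.2]) (by nlinarith [hw.1, hv.2]), sub_sub_cancel, hg,
      mul_div_cancel_right₀ _ hw.1.ne']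
  · rw [slowMap_of_le hw.1.ne' (by nlinarith [hw.1, hv.2]), sub_sub_cancel, hg,
      mul_div_cancel_right₀ _ hw.1.ne']

theorem invBranch_mem (b : Bool) (n : ℕ) {p : ℝ × ℝ} (hp : p ∈ openSq) :
    invBranch b n p ∈ openSq := by
  obtain ⟨u, v⟩ := p
  obtain ⟨hu, hv⟩ := hp
  simp only at hu hv
  have hw := inv_add_mem n hu
  have h1 : 0 < v * ((n : ℝ) + 1 + u)⁻¹ := mul_pos hv.1 hw.1
  have h2 : v * ((n : ℝ) + 1 + u)⁻¹ < 1 := by nlinarith [hw.1, hw.2, hv.1, hv.2]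
  cases b
  · exact ⟨⟨sub_pos.2 hw.2, by simpa [invBranch] using hw.1⟩, h1, h2⟩
  · exact ⟨hw, sub_pos.2 h2, by simpa [invBranch] using h1⟩

theorem injOn_invBranch (b : Bool) (n : ℕ) : InjOn (invBranch b n) openSq := fun p hp q hq h => by
  rw [← slowMap_invBranch b n hp, h, slowMap_invBranch b n hq]

theorem pairwise_disjoint_image_invBranch :
    Pairwise (Function.onFun Disjoint fun i : Bool × ℕ => invBranch i.1 i.2 '' openSq) := by
  rintro ⟨b, n⟩ ⟨c, m⟩ hne
  refine Set.disjoint_left.2 ?_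
  rintro _ ⟨p, hp, rfl⟩ ⟨q, hq, h⟩
  -- `slowMap` recovers the point from its image under either branch
  have hpq : q = p := by
    rw [← slowMap_invBranch c m hq, ← slowMap_invBranch b n hp]
    exact congrArg slowMap h
  subst hpq
  obtain ⟨u, v⟩ := q
  obtain ⟨hu, hv⟩ := hq
  simp only at hu hv h
  have hwn := inv_add_mem n hu
  have hwm := inv_add_mem m hu
  have key : ((m : ℝ) + 1 + u)⁻¹ = ((n : ℝ) + 1 + u)⁻¹ → m = n := fun e => by
    have := inv_injective e
    exact_mod_cast (by linarith : (m : ℝ) = n)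
  cases b <;> cases c <;> simp only [invBranch, Prod.mk.injEq] at h
  · exact hne (by rw [key (by linarith [h.1])])
  · nlinarith [h.1, h.2, hwn.1, hwm.1, hv.1, hv.2]
  · nlinarith [h.1, h.2, hwn.1, hwm.1, hv.1, hv.2]
  · exact hne (by rw [key h.1])

/-- The branches miss only the line `y = 1 - x` and countably many vertical lines. -/
theorem ae_mem_iUnion_image_invBranch :
    ∀ᵐ p ∂volume.restrict openSq, p ∈ ⋃ i : Bool × ℕ, invBranch i.1 i.2 '' openSq := by
  have hZ : (range (fun k : ℤ => (k : ℝ)⁻¹) ∪ range (fun k : ℤ => 1 - (k : ℝ)⁻¹)).Countable :=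
    (countable_range _).union (countable_range _)
  have h1 : ∀ᵐ p : ℝ × ℝ, p.1 ∉ range (fun k : ℤ => (k : ℝ)⁻¹) ∪
      range (fun k : ℤ => 1 - (k : ℝ)⁻¹) :=
    Measure.quasiMeasurePreserving_fst.ae (hZ.ae_notMem volume)
  have h2 : ∀ᵐ p : ℝ × ℝ, p.2 ≠ 1 - p.1 := by
    have hm : MeasurableSet {p : ℝ × ℝ | p.2 = 1 - p.1} :=
      measurableSet_eq_fun measurable_snd (measurable_const.sub measurable_fst)
    have h0 : (volume : Measure (ℝ × ℝ)) {p : ℝ × ℝ | p.2 = 1 - p.1} = 0 := by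
      rw [Measure.volume_eq_prod, Measure.measure_prod_null hm]
      refine Filter.Eventually.of_forall fun x => ?_
      have : Prod.mk x ⁻¹' {p : ℝ × ℝ | p.2 = 1 - p.1} = {1 - x} := by ext; simp
      simp [this]
    simpa [ae_iff] using h0
  -- a number of `(0, 1)` that is not the reciprocal of an integer is `1 / (n + 1 + u)`
  have key : ∀ a ∈ Ioo (0 : ℝ) 1, (∀ k : ℤ, (k : ℝ)⁻¹ ≠ a) →
      ∃ n : ℕ, ∃ u ∈ Ioo (0 : ℝ) 1, ((n : ℝ) + 1 + u)⁻¹ = a := by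
    intro a ha hk
    have h1a : 1 < a⁻¹ := (one_lt_inv₀ ha.1).2 ha.2
    have hfl : 1 ≤ ⌊a⁻¹⌋ := Int.le_floor.2 (by exact_mod_cast h1a.le)
    obtain ⟨n, hn⟩ := Int.eq_ofNat_of_zero_le (sub_nonneg.2 hfl)
    have hn' : ((n : ℝ) + 1) = (⌊a⁻¹⌋ : ℝ) := by
      have : (n : ℤ) + 1 = ⌊a⁻¹⌋ := by omega
      exact_mod_cast this
    refine ⟨n, Int.fract a⁻¹, ⟨?_, Int.fract_lt_one _⟩, ?_⟩
    · refine lt_of_le_of_ne (Int.fract_nonneg _) fun h => hk ⌊a⁻¹⌋ ?_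
      have := Int.floor_add_fract a⁻¹
      rw [← h, add_zero] at this
      rw [this, inv_inv]
    · rw [hn', Int.floor_add_fract, inv_inv]
  filter_upwards [ae_restrict_of_ae h1, ae_restrict_of_ae h2,
    ae_restrict_mem measurableSet_openSq] with p hp1 hp2 hp
  obtain ⟨x, y⟩ := p
  obtain ⟨hx, hy⟩ := hp
  simp only [mem_union, mem_range, not_or, not_exists] at hp1 hp2 hx hy
  rw [mem_iUnion]
  rcases lt_or_gt_of_ne hp2 with h | h
  · obtain ⟨n, u, hu, hn⟩ := key (1 - x) ⟨by linarith [hx.2], by linarith [hx.1]⟩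
      fun k hk => hp1.2 k (by linarith)
    have hx' : 0 < 1 - x := by linarith [hx.2]
    refine ⟨(false, n), (u, y / (1 - x)), ⟨hu, div_pos hy.1 hx', (div_lt_one hx').2 h⟩, ?_⟩
    simp [invBranch, hn, hx'.ne']
  · obtain ⟨n, u, hu, hn⟩ := key x hx fun k hk => hp1.1 k hk
    refine ⟨(true, n), (u, (1 - y) / x), ⟨hu, div_pos (by linarith [hy.2]) hx.1,
      (div_lt_one hx.1).2 (by linarith)⟩, ?_⟩
    simp [invBranch, hn, hx.1.ne']

/-! ### Change of variables along a branch -/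
theorem det_prod_lowerTriangular (a b c : ℝ) :
    ((a • ContinuousLinearMap.fst ℝ ℝ ℝ).prod
      (b • ContinuousLinearMap.fst ℝ ℝ ℝ + c • ContinuousLinearMap.snd ℝ ℝ ℝ)).det = a * c := by
  rw [ContinuousLinearMap.det, ← LinearMap.det_toMatrix (Module.Basis.finTwoProd ℝ),
    Matrix.det_fin_two]
  simp [LinearMap.toMatrix_apply]

theorem hasFDerivAt_invBranch (b : Bool) (n : ℕ) {p : ℝ × ℝ} (hp : p ∈ openSq) :
    ∃ f' : ℝ × ℝ →L[ℝ] ℝ × ℝ, HasFDerivAt (invBranch b n) f' p ∧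
      |f'.det| = (((n : ℝ) + 1 + p.1)⁻¹) ^ 3 := by
  have hw := inv_add_mem n hp.1
  set w := ((n : ℝ) + 1 + p.1)⁻¹ with hwdef
  have h0 : (n : ℝ) + 1 + p.1 ≠ 0 := fun h => by simp [hwdef, h] at hw
  have h1 : HasFDerivAt (fun q : ℝ × ℝ => ((n : ℝ) + 1 + q.1)⁻¹)
      ((-w ^ 2) • ContinuousLinearMap.fst ℝ ℝ ℝ) p := by
    have h := (hasDerivAt_inv h0).comp_hasFDerivAt p
      ((hasFDerivAt_fst (𝕜 := ℝ) (p := p)).const_add ((n : ℝ) + 1))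
    refine h.congr_fderiv ?_
    rw [hwdef, inv_pow]
  have h2 : HasFDerivAt (fun q : ℝ × ℝ => q.2 * ((n : ℝ) + 1 + q.1)⁻¹)
      ((p.2 * -w ^ 2) • ContinuousLinearMap.fst ℝ ℝ ℝ + w • ContinuousLinearMap.snd ℝ ℝ ℝ) p := by
    refine (HasFDerivAt.mul (hasFDerivAt_snd (𝕜 := ℝ) (p := p)) h1).congr_fderiv ?_
    rw [smul_smul]
  have h3 : |w ^ 2 * w| = w ^ 3 := by
    rw [← pow_succ, abs_of_pos (pow_pos hw.1 3)]
  cases b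
  · refine ⟨(w ^ 2 • ContinuousLinearMap.fst ℝ ℝ ℝ).prod _,
      HasFDerivAt.prodMk ((h1.const_sub 1).congr_fderiv (by ext <;> simp)) h2, ?_⟩
    rw [det_prod_lowerTriangular, h3]
  · refine ⟨((-w ^ 2) • ContinuousLinearMap.fst ℝ ℝ ℝ).prod
        ((-(p.2 * -w ^ 2)) • ContinuousLinearMap.fst ℝ ℝ ℝ +
          (-w) • ContinuousLinearMap.snd ℝ ℝ ℝ),
      HasFDerivAt.prodMk h1 ((h2.const_sub 1).congr_fderiv
        (by ext <;> simp)), ?_⟩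
    rw [det_prod_lowerTriangular, neg_mul_neg, h3]

theorem measurableSet_image_invBranch (b : Bool) (n : ℕ) {A : Set (ℝ × ℝ)}
    (hA : MeasurableSet A) : MeasurableSet (invBranch b n '' (A ∩ openSq)) := by
  choose! f' hf' _ using fun p hp => hasFDerivAt_invBranch b n (p := p) hp
  exact measurable_image_of_fderivWithin (hA.inter measurableSet_openSq)
    (fun p hp => (hf' p hp.2).hasFDerivWithinAt) ((injOn_invBranch b n).mono inter_subset_right)

/-- The Jacobian of the branch with partial quotient `n + 1` is `(n + 1 + u)⁻³`; the remaining
factor is the density `1 / x` at the image point. -/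
theorem invMeasure_image_invBranch (b : Bool) (n : ℕ) {A : Set (ℝ × ℝ)} (hA : MeasurableSet A) :
    invMeasure (invBranch b n '' (A ∩ openSq)) = ∫⁻ p in A ∩ openSq,
      ENNReal.ofReal (((n : ℝ) + 1 + p.1)⁻¹ ^ 3 * (invBranch b n p).1⁻¹) := by
  choose! f' hf' hdet using fun p hp => hasFDerivAt_invBranch b n (p := p) hp
  have hsub : invBranch b n '' (A ∩ openSq) ⊆ openSq :=
    image_subset_iff.2 fun p hp => invBranch_mem b n hp.2
  have hm := measurableSet_image_invBranch b n hA
  have hAm := hA.inter measurableSet_openSq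
  rw [invMeasure_eq, withDensity_apply _ hm, Measure.restrict_restrict hm,
    inter_eq_self_of_subset_left hsub,
    lintegral_image_eq_lintegral_abs_det_fderiv_mul volume hAm
      (fun p hp => (hf' p hp.2).hasFDerivWithinAt)
      ((injOn_invBranch b n).mono inter_subset_right)]
  refine setLIntegral_congr_fun hAm fun p hp => ?_
  rw [hdet p hp.2, ENNReal.ofReal_mul (pow_nonneg (inv_add_mem n hp.2.1).1.le 3)]

theorem invMeasure_apply {A : Set (ℝ × ℝ)} (hA : MeasurableSet A) :
    invMeasure A = ∫⁻ p in A ∩ openSq, ENNReal.ofReal p.1⁻¹ := by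
  rw [invMeasure_eq, withDensity_apply _ hA, Measure.restrict_restrict hA]

/-- The transfer operator of `slowMap` fixes the density `1 / x`: the two branches with partial
quotient `n + 1` contribute `1 / ((n + u) (n + 1 + u))` together, and this sum telescopes. -/
theorem tsum_branch_density {p : ℝ × ℝ} (hp : p ∈ openSq) :
    ∑' i : Bool × ℕ,
      ENNReal.ofReal (((i.2 : ℝ) + 1 + p.1)⁻¹ ^ 3 * (invBranch i.1 i.2 p).1⁻¹) =
        ENNReal.ofReal p.1⁻¹ := by
  have hu : 0 < p.1 := hp.1.1
  have hnn : ∀ n : ℕ, ((n : ℝ) + 1 + p.1)⁻¹ ≤ ((n : ℝ) + p.1)⁻¹ := fun n =>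
    inv_anti₀ (by positivity) (by linarith)
  have hsum : HasSum (fun n : ℕ => ((n : ℝ) + p.1)⁻¹ - ((n : ℝ) + 1 + p.1)⁻¹) p.1⁻¹ := by
    rw [hasSum_iff_tendsto_nat_of_nonneg fun n => sub_nonneg.2 (hnn n)]
    have hr : ∀ n : ℕ, ∑ i ∈ Finset.range n, (((i : ℝ) + p.1)⁻¹ - ((i : ℝ) + 1 + p.1)⁻¹) =
        p.1⁻¹ - ((n : ℝ) + p.1)⁻¹ := fun n => by
      have := Finset.sum_range_sub' (fun i : ℕ => ((i : ℝ) + p.1)⁻¹) n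
      simpa using this
    simp only [hr]
    have ht : Filter.Tendsto (fun n : ℕ => ((n : ℝ) + p.1)⁻¹) Filter.atTop (nhds 0) :=
      (Filter.tendsto_atTop_add_const_right _ _ tendsto_natCast_atTop_atTop).inv_tendsto_atTop
    simpa using ht.const_sub p.1⁻¹
  rw [ENNReal.tsum_prod', tsum_bool, ← ENNReal.tsum_add, ← hsum.tsum_eq,
    ENNReal.ofReal_tsum_of_nonneg (fun n => sub_nonneg.2 (hnn n)) hsum.summable]
  refine tsum_congr fun n => ?_
  have hb : ∀ b, 0 ≤ ((n : ℝ) + 1 + p.1)⁻¹ ^ 3 * (invBranch b n p).1⁻¹ := fun b =>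
    mul_nonneg (by positivity) (inv_nonneg.2 (invBranch_mem b n hp).1.1.le)
  rw [← ENNReal.ofReal_add (hb _) (hb _)]
  congr 1
  have h1 : (n : ℝ) + p.1 ≠ 0 := by positivity
  have h2 : (n : ℝ) + 1 + p.1 ≠ 0 := by positivity
  have h3 : 1 - ((n : ℝ) + 1 + p.1)⁻¹ = (n + p.1) / (n + 1 + p.1) := by
    field_simp
    ring
  simp only [invBranch]
  rw [h3]
  field_simp
  ring

/-! ### The infinite invariant measure -/
theorem image_invBranch_subset_preimage (b : Bool) (n : ℕ) (A : Set (ℝ × ℝ)) :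
    invBranch b n '' (A ∩ openSq) ⊆ slowMap ⁻¹' A := by
  rintro _ ⟨p, hp, rfl⟩
  rw [mem_preimage, slowMap_invBranch b n hp.2]
  exact hp.1

theorem measurePreserving_slowMap : MeasurePreserving slowMap invMeasure invMeasure := by
  refine ⟨measurable_slowMap, Measure.ext fun A hA => ?_⟩
  rw [Measure.map_apply measurable_slowMap hA]
  have hinter : ∀ i : Bool × ℕ, slowMap ⁻¹' A ∩ invBranch i.1 i.2 '' openSq =
      invBranch i.1 i.2 '' (A ∩ openSq) := by
    intro i
    refine Subset.antisymm ?_ (subset_inter (image_invBranch_subset_preimage _ _ _)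
      (image_mono inter_subset_right))
    rintro _ ⟨hpA, p, hp, rfl⟩
    rw [mem_preimage, slowMap_invBranch _ _ hp] at hpA
    exact ⟨p, ⟨hpA, hp⟩, rfl⟩
  have hcov : slowMap ⁻¹' A =ᵐ[invMeasure]
      ⋃ i : Bool × ℕ, invBranch i.1 i.2 '' (A ∩ openSq) := by
    have hae : ∀ᵐ p ∂invMeasure, p ∈ ⋃ i : Bool × ℕ, invBranch i.1 i.2 '' openSq := by
      rw [invMeasure_eq]
      exact (withDensity_absolutelyContinuous _ _).ae_le ae_mem_iUnion_image_invBranch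
    simp only [← hinter, ← inter_iUnion]
    filter_upwards [hae] with p hp
    exact propext ⟨fun h => ⟨h, hp⟩, fun h => h.1⟩
  rw [measure_congr hcov, measure_iUnion
    (fun i j hij => (pairwise_disjoint_image_invBranch hij).mono
      (image_mono inter_subset_right) (image_mono inter_subset_right))
    fun i => measurableSet_image_invBranch _ _ hA]
  simp only [fun i : Bool × ℕ => invMeasure_image_invBranch i.1 i.2 hA]
  rw [← lintegral_tsum, invMeasure_apply hA]
  · exact setLIntegral_congr_fun (hA.inter measurableSet_openSq)
      fun p hp => tsum_branch_density hp.2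
  · rintro ⟨b, n⟩
    refine Measurable.aemeasurable ?_
    cases b <;> simp only [invBranch] <;> fun_prop

/-! ### Bounded invariant densities vanish -/
theorem lebSq_eq : lebSq = volume.restrict openSq := by
  rw [lebSq, Measure.restrict_congr_set openSq_ae_eq_unitSq]

/-- Near the segment `x = 0`, Lebesgue measure is small relative to `dx dy / x`. -/
theorem lebSq_le_mul_invMeasure {ε : ℝ} (hε : 0 ≤ ε) {A : Set (ℝ × ℝ)} (hA : MeasurableSet A)
    (h : ∀ p ∈ A ∩ openSq, p.1 ≤ ε) : lebSq A ≤ ENNReal.ofReal ε * invMeasure A := by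
  rw [lebSq_eq, Measure.restrict_apply hA, invMeasure_apply hA,
    ← lintegral_const_mul' _ _ ENNReal.ofReal_ne_top, ← setLIntegral_one]
  refine setLIntegral_mono' (hA.inter measurableSet_openSq) fun p hp => ?_
  rw [← ENNReal.ofReal_mul hε, ENNReal.one_le_ofReal, ← div_eq_mul_inv, one_le_div hp.2.1.1]
  exact h p hp

/-- Away from `x = 0`, each upper branch carries a definite share of `dx dy / x`: the density of
that share at `(u, v)` is `u / (N + 1 + u) ^ 2`. -/
theorem mul_invMeasure_le_image {ε : ℝ} (hε : 0 ≤ ε) (N : ℕ) {A : Set (ℝ × ℝ)}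
    (hA : MeasurableSet A) (h : ∀ p ∈ A, ε ≤ p.1) :
    ENNReal.ofReal (ε / (N + 2) ^ 2) * invMeasure A ≤
      invMeasure (invBranch true N '' (A ∩ openSq)) := by
  rw [invMeasure_image_invBranch _ _ hA, invMeasure_apply hA,
    ← lintegral_const_mul' _ _ ENNReal.ofReal_ne_top]
  refine setLIntegral_mono' (hA.inter measurableSet_openSq) fun p hp => ?_
  rw [← ENNReal.ofReal_mul (by positivity)]
  refine ENNReal.ofReal_le_ofReal ?_
  have hu := hp.2.1
  have h0 : 0 < p.1 := hu.1
  have hlt : p.1 < 1 := hu.2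
  have hw : (0 : ℝ) < N + 1 + p.1 := by positivity
  have e : ((N : ℝ) + 1 + p.1)⁻¹ ^ 3 * (invBranch true N p).1⁻¹ = 1 / (N + 1 + p.1) ^ 2 := by
    simp only [invBranch]
    field_simp
  rw [e, ← div_eq_mul_inv, div_right_comm]
  exact div_le_div₀ zero_le_one ((div_le_one h0).2 (h p hp.1)) (by positivity)
    (pow_le_pow_left₀ hw.le (by linarith) 2)

instance sigmaFinite_invMeasure : SigmaFinite invMeasure := by
  rw [invMeasure]
  have : SigmaFinite lebSq := by rw [lebSq]; infer_instance
  exact SigmaFinite.withDensity_of_ne_top (by simp)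

theorem invMeasure_unitSq : invMeasure unitSq = ∞ := by
  have hm : MeasurableSet unitSq := measurableSet_Icc.prod measurableSet_Icc
  have h1 : ∫⁻ x in Icc (0 : ℝ) 1, ENNReal.ofReal x⁻¹ = ∞ := by
    by_contra h
    have hi : IntegrableOn (fun x : ℝ => x⁻¹) (Icc 0 1) := by
      refine ⟨measurable_inv.aestronglyMeasurable, ?_⟩
      rw [hasFiniteIntegral_iff_ofReal]
      · exact lt_top_iff_ne_top.2 h
      · filter_upwards [ae_restrict_mem measurableSet_Icc] with x hx
        exact inv_nonneg.2 hx.1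
    have := (intervalIntegrable_iff_integrableOn_Icc_of_le zero_le_one).2 hi
    rw [intervalIntegrable_inv_iff] at this
    simp at this
  rw [invMeasure, withDensity_apply _ hm, lebSq, Measure.restrict_restrict hm, inter_self, unitSq,
    Measure.volume_eq_prod, ← Measure.prod_restrict, lintegral_prod _ (by fun_prop)]
  simp [h1]

/-- A maximum principle: a bound `ν ≤ c * invMeasure` on an invariant `ν` with bounded Lebesgue
density is never sharp. On `x < ε` the density bound gives the constant `c / 2`. A point with
`ε ≤ x` has a preimage with first coordinate at most `1 / (N + 1)`, where the constant `c / 2` is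
also available, and a share of the mass at least `ε / (N + 2) ^ 2` comes from such preimages. -/
theorem exists_lt_invMeasure_bound {ν : Measure (ℝ × ℝ)} [IsFiniteMeasure ν]
    (hν : MeasurePreserving slowMap ν ν) {C : ℝ} (hC : 0 < C)
    (hle : ∀ A, ν A ≤ ENNReal.ofReal C * lebSq A) {c : ℝ} (hc : 0 < c)
    (h : ∀ A, MeasurableSet A → invMeasure A ≠ ∞ → ν.real A ≤ c * invMeasure.real A) :
    ∃ c' < c, 0 ≤ c' ∧
      ∀ A, MeasurableSet A → invMeasure A ≠ ∞ → ν.real A ≤ c' * invMeasure.real A := by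
  have hsmall : ∀ ε : ℝ, 0 ≤ ε → C * ε ≤ c / 2 → ∀ A, MeasurableSet A → invMeasure A ≠ ∞ →
      (∀ p ∈ A ∩ openSq, p.1 ≤ ε) → ν.real A ≤ c / 2 * invMeasure.real A := by
    intro ε hε hCε A hA hfin hAε
    have h1 : ν A ≤ ENNReal.ofReal (c / 2) * invMeasure A :=
      calc ν A ≤ ENNReal.ofReal C * (ENNReal.ofReal ε * invMeasure A) :=
            (hle A).trans (by gcongr; exact lebSq_le_mul_invMeasure hε hA hAε)
        _ = ENNReal.ofReal (C * ε) * invMeasure A := by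
            rw [← mul_assoc, ENNReal.ofReal_mul hC.le]
        _ ≤ _ := by gcongr
    have h2 := ENNReal.toReal_mono (ENNReal.mul_ne_top ENNReal.ofReal_ne_top hfin) h1
    rwa [ENNReal.toReal_mul, ENNReal.toReal_ofReal (by positivity)] at h2
  -- `N` is chosen so that `C * x ≤ c / 2` on the image of the upper branch `N`, where
  -- `x ≤ 1 / (N + 1)`; `ε` so that the same holds for `x ≤ ε`
  obtain ⟨N, hN⟩ := exists_nat_gt (2 * C / c)
  set ε := c / (2 * C) with hεdef
  have hε : 0 < ε := by positivity
  set η := ε / ((N : ℝ) + 2) ^ 2 with hηdef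
  have hη : 0 < η := by positivity
  refine ⟨max (c / 2) (c - c / 2 * η), max_lt (by linarith) (by nlinarith),
    le_max_of_le_left (by positivity), fun A hA hfin => ?_⟩
  set E : Set (ℝ × ℝ) := {p | p.1 < ε}
  have hE : MeasurableSet E := measurableSet_lt measurable_fst measurable_const
  have hA1 : ν.real (A ∩ E) ≤ c / 2 * invMeasure.real (A ∩ E) :=
    hsmall ε hε.le (by rw [hεdef]; field_simp; rfl) _ (hA.inter hE)
      (measure_ne_top_of_subset inter_subset_left hfin) fun p hp => le_of_lt hp.1.2
  -- the part of the preimage in the strip of the upper branch `N` is bounded with `c / 2`,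
  -- the rest with `c`
  have hA2 : ν.real (A \ E) ≤ (c - c / 2 * η) * invMeasure.real (A \ E) := by
    set D := A \ E
    have hD : MeasurableSet D := hA.diff hE
    have hDfin : invMeasure D ≠ ∞ := measure_ne_top_of_subset sdiff_subset hfin
    have hSD : MeasurableSet (slowMap ⁻¹' D) := measurable_slowMap hD
    have hSfin : invMeasure (slowMap ⁻¹' D) ≠ ∞ := by
      rwa [measurePreserving_slowMap.measure_preimage hD.nullMeasurableSet]
    set B := invBranch true N '' (D ∩ openSq)
    have hB : MeasurableSet B := measurableSet_image_invBranch _ _ hD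
    have hBS : B ⊆ slowMap ⁻¹' D := image_invBranch_subset_preimage _ _ _
    have hBfin : invMeasure B ≠ ∞ := measure_ne_top_of_subset hBS hSfin
    have e1 : ν.real D = ν.real B + ν.real (slowMap ⁻¹' D \ B) := by
      rw [← hν.measureReal_preimage hD.nullMeasurableSet, ← measureReal_inter_add_sdiff hB,
        inter_eq_self_of_subset_right hBS]
    have e2 : invMeasure.real D = invMeasure.real B + invMeasure.real (slowMap ⁻¹' D \ B) := by
      rw [← measurePreserving_slowMap.measureReal_preimage hD.nullMeasurableSet,
        ← measureReal_inter_add_sdiff hB hSfin, inter_eq_self_of_subset_right hBS]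
    have b1 : ν.real B ≤ c / 2 * invMeasure.real B := by
      refine hsmall ((N : ℝ) + 1)⁻¹ (by positivity) ?_ B hB hBfin ?_
      · rw [← div_eq_mul_inv, div_le_iff₀ (by positivity)]
        rw [div_lt_iff₀ hc] at hN
        linarith
      · rintro _ ⟨⟨p, hp, rfl⟩, -⟩
        exact inv_anti₀ (by positivity) (by linarith [hp.2.1.1])
    have b2 := h _ (hSD.diff hB) (measure_ne_top_of_subset sdiff_subset hSfin)
    have b3 : η * invMeasure.real D ≤ invMeasure.real B := by
      have := ENNReal.toReal_mono hBfin
        (mul_invMeasure_le_image hε.le N hD fun p hp => not_lt.1 hp.2)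
      rwa [ENNReal.toReal_mul, ENNReal.toReal_ofReal hη.le] at this
    nlinarith
  rw [← measureReal_inter_add_sdiff hE, ← measureReal_inter_add_sdiff (s := A) hE hfin, mul_add]
  exact add_le_add (hA1.trans (by gcongr; exact le_max_left _ _))
    (hA2.trans (by gcongr; exact le_max_right _ _))

/-- The least `c` with `ν ≤ c * invMeasure` exists, and the maximum principle leaves only
`c = 0`. -/
theorem eq_zero_of_le_lebSq {ν : Measure (ℝ × ℝ)} [IsFiniteMeasure ν]
    (hν : MeasurePreserving slowMap ν ν) {C : ℝ} (hC : 0 < C)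
    (hle : ∀ A, ν A ≤ ENNReal.ofReal C * lebSq A) : ν = 0 := by
  set K : Set ℝ := {c | 0 ≤ c ∧
    ∀ A, MeasurableSet A → invMeasure A ≠ ∞ → ν.real A ≤ c * invMeasure.real A} with hK
  have hclosed : IsClosed K := by
    simp only [hK, ofPred_and, ofPred_forall]
    exact isClosed_Ici.inter (isClosed_iInter fun A => isClosed_iInter fun _ =>
      isClosed_iInter fun _ => isClosed_le continuous_const (by fun_prop))
  have hbdd : BddBelow K := ⟨0, fun c hc => hc.1⟩
  have hne : K.Nonempty := by
    refine ⟨C, hC.le, fun A hA hfin => ?_⟩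
    have h1 : lebSq A ≤ invMeasure A := by
      simpa using lebSq_le_mul_invMeasure zero_le_one hA fun p hp => hp.2.1.2.le
    have h2 := ENNReal.toReal_mono (ENNReal.mul_ne_top ENNReal.ofReal_ne_top hfin)
      ((hle A).trans (mul_le_mul_right h1 _))
    rwa [ENNReal.toReal_mul, ENNReal.toReal_ofReal hC.le] at h2
  have hmem : sInf K ∈ K := hclosed.csInf_mem hne hbdd
  have h0 : sInf K = 0 := by
    refine (hmem.1.eq_or_lt).elim Eq.symm fun hpos => ?_
    obtain ⟨c', hlt, hc'⟩ := exists_lt_invMeasure_bound hν hC hle hpos hmem.2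
    exact absurd (csInf_le hbdd hc') (not_le.2 hlt)
  rw [← Measure.measure_univ_eq_zero, ← iUnion_spanningSets invMeasure]
  refine measure_iUnion_null fun k => ?_
  have := hmem.2 _ (measurableSet_spanningSets invMeasure k)
    (measure_spanningSets_lt_top invMeasure k).ne
  rw [h0, zero_mul] at this
  exact (measureReal_eq_zero_iff).1 (le_antisymm this measureReal_nonneg)

theorem mainTheorem3 :
    (¬ ∃ ν : Measure (ℝ × ℝ), IsProbabilityMeasure ν ∧ ν ≪ lebSq ∧
      (∃ C : ℝ≥0, ∀ᵐ p ∂lebSq, ν.rnDeriv lebSq p ≤ (C : ℝ≥0∞)) ∧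
      MeasurePreserving slowMap ν ν) ∧
    (∃ μ : Measure (ℝ × ℝ), μ ≪ lebSq ∧ lebSq ≪ μ ∧ SigmaFinite μ ∧ μ unitSq = ∞ ∧
      MeasurePreserving slowMap μ μ) := by
  have hσ : SigmaFinite lebSq := by rw [lebSq]; infer_instance
  constructor
  · rintro ⟨ν, hprob, hac, ⟨C, hC⟩, hν⟩
    -- `C` may be `0`, while the lemma asks for a positive bound
    refine IsProbabilityMeasure.ne_zero ν
      (eq_zero_of_le_lebSq hν (C := C + 1) (by positivity) fun A => ?_)
    have h1 : ν ≤ (C : ℝ≥0∞) • lebSq := by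
      rw [← Measure.withDensity_rnDeriv_eq ν lebSq hac, ← withDensity_const]
      exact withDensity_mono hC
    refine (h1 A).trans ?_
    rw [Measure.smul_apply, smul_eq_mul]
    gcongr
    rw [← ENNReal.ofReal_coe_nnreal]
    exact ENNReal.ofReal_le_ofReal (by linarith)
  · refine ⟨invMeasure, withDensity_absolutelyContinuous _ _, ?_, inferInstance,
      invMeasure_unitSq, measurePreserving_slowMap⟩
    rw [invMeasure_eq, lebSq_eq]
    refine withDensity_absolutelyContinuous' (by fun_prop) ?_
    filter_upwards [ae_restrict_mem measurableSet_openSq] with p hp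
    exact (ENNReal.ofReal_pos.2 (inv_pos.2 hp.1.1)).ne'
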